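/- For a finite $3$-uniform hypergraph $H=(V,E)$, its Lagrangian is $\lambda(H)=\max \sum_{e\in E}\prod_{i\in e}x_i$, the maximum being over all $x\in\mathbb{R}^V$ with $x_i\ge 0$ for all $i\in V$ and $\sum_{i\in V}x_i=1$. Let $\lambda_3(m)$ be the maximum of $\lambda(H)$ over all finite $3$-uniform hypergraphs $H$ with exactly $m$ edges, and let $C_{3,m}$ be the $3$-uniform hypergraph whose edges are the first $m$ three-element sets of natural numbers in the colexicographic order (in which $A$ precedes $B\neq A$ if and only if $\max(A\,\triangle\, B)\in B$). There is an absolute constant $c>0$ such that for all integers $t\ge 2$ and $m\ge 0$ with $$\binom{t-1}{3}\le m\le \binom{t}{3}-(t-2)-c\,t^{2/3},$$ the maximum $\lambda_3(m)$ exists and $$\lambda_3(m)=\frac{\binom{t-1}{3}}{(t-1)^3}=\lambda(C_{3,m}).$$ In particular, the Frankl–Füredi conjecture, $\lambda_3(m)=\lambda(C_{3,m})$, holds for these $m$. -/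

import Mathlib

/-- An `r`-uniform hypergraph (`r`-graph) with finite vertex set `verts`: every edge is an
`r`-element subset of the vertex set. Isolated vertices are allowed. -/
structure RGraph (α : Type*) (r : ℕ) where
  verts : Finset α
  edges : Finset (Finset α)
  subset_verts : ∀ e ∈ edges, e ⊆ verts
  card_eq : ∀ e ∈ edges, e.card = r

namespace RGraph

variable {α : Type*} {r : ℕ}

/-- The weight polynomial `w(G, x) = ∑_{e ∈ E} ∏_{i ∈ e} x_i`. -/
def weight (G : RGraph α r) (x : α → ℝ) : ℝ :=
  ∑ e ∈ G.edges, ∏ i ∈ e, x i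

/-- Legal weightings: nonnegative weights on the vertices, with total weight `1`.
(The values of `x` outside the vertex set play no role.) -/
def IsLegal (G : RGraph α r) (x : α → ℝ) : Prop :=
  (∀ i ∈ G.verts, 0 ≤ x i) ∧ ∑ i ∈ G.verts, x i = 1

/-- The Lagrangian `λ(G)`: the maximum of `w(G, x)` over all legal weightings `x`. That the
supremum is attained is `RGraph.isGreatest_lagrangian` below. -/
noncomputable def lagrangian (G : RGraph α r) : ℝ :=
  sSup {w : ℝ | ∃ x : α → ℝ, G.IsLegal x ∧ w = G.weight x}

/-- On a nonempty vertex set the Lagrangian is a maximum. -/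
theorem isGreatest_lagrangian (G : RGraph α r) (hG : G.verts.Nonempty) :
    IsGreatest {w : ℝ | ∃ x : α → ℝ, G.IsLegal x ∧ w = G.weight x} G.lagrangian := by
  classical
  let ext : (G.verts → ℝ) → α → ℝ := fun y i => if h : i ∈ G.verts then y ⟨i, h⟩ else 0
  have hcont : Continuous fun y : G.verts → ℝ => G.weight (ext y) := by
    unfold weight
    refine continuous_finsetSum _ fun e _ => continuous_finsetProd _ fun i _ => ?_
    by_cases h : i ∈ G.verts
    · simpa [ext, h] using continuous_apply (⟨i, h⟩ : G.verts)
    · simpa [ext, h] using continuous_const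
  have hset : {w : ℝ | ∃ x : α → ℝ, G.IsLegal x ∧ w = G.weight x}
      = (fun y : G.verts → ℝ => G.weight (ext y)) '' stdSimplex ℝ G.verts := by
    ext w
    constructor
    · rintro ⟨x, ⟨h0, h1⟩, rfl⟩
      refine ⟨fun i => x i, ⟨fun i => h0 i i.2, ?_⟩, ?_⟩
      · rw [← h1]
        exact Finset.sum_coe_sort G.verts x
      · refine Finset.sum_congr rfl fun e he => Finset.prod_congr rfl fun i hi => ?_
        simp [ext, G.subset_verts e he hi]
    · rintro ⟨y, ⟨h0, h1⟩, rfl⟩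
      refine ⟨ext y, ⟨fun i hi => ?_, ?_⟩, rfl⟩
      · simpa [ext, hi] using h0 ⟨i, hi⟩
      · rw [← h1, ← Finset.sum_coe_sort G.verts (ext y)]
        exact Finset.sum_congr rfl fun i _ => by simp [ext]
  have hne : (stdSimplex ℝ G.verts).Nonempty := by
    obtain ⟨i, hi⟩ := hG
    exact ⟨_, single_mem_stdSimplex ℝ (⟨i, hi⟩ : G.verts)⟩
  unfold lagrangian
  rw [hset]
  exact ((isCompact_stdSimplex ℝ G.verts).image hcont).isGreatest_sSup (hne.image _)

end RGraph

/-- The set of all Lagrangians of `r`-graphs (on arbitrary finite vertex sets) with exactly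
`m` edges. -/
def lagrangianValues (r m : ℕ) : Set ℝ :=
  {v : ℝ | ∃ (α : Type) (H : RGraph α r), H.edges.card = m ∧ v = H.lagrangian}

/-- `λ_r(m)`: the maximum Lagrangian of an `r`-graph with `m` edges. -/
noncomputable def maxLagrangian (r m : ℕ) : ℝ :=
  sSup (lagrangianValues r m)

/-- The first `m` sets of size `r ≥ 1` of natural numbers in the colexicographic order: those with
fewer than `m` predecessors among the `r`-sets. They are all contained in `{0, …, m + r - 1}`,
and that set contains the predecessors of each of its subsets; see the three facts below. -/
def colexEdges (r m : ℕ) : Finset (Finset ℕ) :=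
  ((Finset.range (m + r)).powersetCard r).filter fun A =>
    (((Finset.range (m + r)).powersetCard r).filter fun B => toColex B < toColex A).card < m

theorem card_of_mem_colexEdges {r m : ℕ} {A : Finset ℕ} (hA : A ∈ colexEdges r m) :
    A.card = r :=
  (Finset.mem_powersetCard.1 (Finset.mem_filter.1 hA).1).2

theorem isInitSeg_colexEdges (r m : ℕ) : Finset.Colex.IsInitSeg (colexEdges r m) r := by
  refine ⟨fun A hA => card_of_mem_colexEdges hA, ?_⟩
  rintro s t hs ⟨hts, ht⟩
  obtain ⟨h1, h2⟩ := Finset.mem_filter.1 hs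
  have hsub := (Finset.mem_powersetCard.1 h1).1
  refine Finset.mem_filter.2 ⟨Finset.mem_powersetCard.2 ⟨?_, ht⟩, ?_⟩
  · intro b hb
    exact Finset.mem_range.2 (Finset.Colex.forall_lt_mono hts.le
      (fun c hc => Finset.mem_range.1 (hsub hc)) b hb)
  · refine lt_of_le_of_lt (Finset.card_le_card ?_) h2
    exact Finset.monotone_filter_right _ fun B _ hB => lt_trans hB hts

theorem card_colexEdges {r : ℕ} (hr : 1 ≤ r) (m : ℕ) : (colexEdges r m).card = m := by
  set P : Finset (Finset ℕ) := (Finset.range (m + r)).powersetCard r with hP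
  let S : Finset (Colex (Finset ℕ)) := P.map toColex.toEmbedding
  have hS : S.card = P.card := Finset.card_map _
  have hm : m ≤ S.card := by
    rw [hS, hP, Finset.card_powersetCard, Finset.card_range, ← Nat.choose_symm_add]
    calc m ≤ (m + 1).choose m := by simp
      _ ≤ (m + r).choose m := Nat.choose_le_choose _ (by omega)
  let f := S.orderEmbOfFin rfl
  have hinj : Function.Injective fun j => ofColex (f j) := ofColex.injective.comp f.injective
  have hmem : ∀ A, A ∈ P ↔ ∃ i, f i = toColex A := by
    intro A
    have h := Set.ext_iff.1 (Finset.range_orderEmbOfFin S rfl) (toColex A)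
    simp only [Set.mem_range, Finset.mem_coe] at h
    rw [h]
    simp [S]
  have hcount : ∀ i : Fin S.card, (P.filter fun B => toColex B < f i).card = i := by
    intro i
    have : (P.filter fun B => toColex B < f i) = (Finset.Iio i).image fun j => ofColex (f j) := by
      ext B
      simp only [Finset.mem_filter, hmem, Finset.mem_image, Finset.mem_Iio]
      constructor
      · rintro ⟨⟨j, hj⟩, hB⟩
        rw [← hj] at hB
        exact ⟨j, f.lt_iff_lt.1 hB, by rw [hj]; rfl⟩
      · rintro ⟨j, hj, rfl⟩
        exact ⟨⟨j, rfl⟩, f.lt_iff_lt.2 hj⟩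
    rw [this, Finset.card_image_of_injective _ hinj]
    simp
  have : colexEdges r m
      = (Finset.univ.filter fun i : Fin S.card => (i : ℕ) < m).image fun j => ofColex (f j) := by
    ext B
    simp only [colexEdges, ← hP, Finset.mem_filter, hmem, Finset.mem_image, Finset.mem_univ,
      true_and]
    constructor
    · rintro ⟨⟨j, hj⟩, hB⟩
      rw [← hj, hcount] at hB
      exact ⟨j, hB, by rw [hj]; rfl⟩
    · rintro ⟨j, hj, rfl⟩
      exact ⟨⟨j, rfl⟩, (hcount j).trans_lt hj⟩
  rw [this, Finset.card_image_of_injective _ hinj]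
  rw [Fin.card_filter_val_lt]
  exact min_eq_right hm

/-- `C_{r,m}`: the `r`-graph whose edges are the first `m` sets of size `r` in the colexicographic
order; its vertices are the elements of the edges. -/
def colexGraph (r m : ℕ) : RGraph ℕ r where
  verts := (colexEdges r m).biUnion id
  edges := colexEdges r m
  subset_verts := fun _ he => Finset.subset_biUnion_of_mem id he
  card_eq := fun _ he => card_of_mem_colexEdges he

theorem two_mul_sum_powersetCard_two {α : Type*} (V : Finset α) (x : α → ℝ) :
    2 * ∑ e ∈ V.powersetCard 2, ∏ i ∈ e, x i = (∑ i ∈ V, x i) ^ 2 - ∑ i ∈ V, x i ^ 2 := by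
  classical
  induction V using Finset.induction_on with
  | empty => rw [Finset.powersetCard_eq_empty.2 (by simp)]; simp
  | insert a s ha ih =>
    rw [Finset.powersetCard_succ_insert ha, Finset.sum_union, Finset.sum_image,
      Finset.sum_insert ha, Finset.sum_insert ha]
    · have h : ∑ e ∈ s.powersetCard 1, ∏ i ∈ insert a e, x i = x a * ∑ i ∈ s, x i := by
        rw [Finset.powersetCard_one, Finset.sum_map, Finset.mul_sum]
        refine Finset.sum_congr rfl fun i hi => ?_
        have : a ≠ i := by rintro rfl; exact ha hi
        simp [Finset.prod_pair this]
      rw [h]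
      linear_combination ih
    · intro e he f hf hef
      have h1 : a ∉ e := fun h => ha ((Finset.mem_powersetCard.1 he).1 h)
      have h2 : a ∉ f := fun h => ha ((Finset.mem_powersetCard.1 hf).1 h)
      rw [← Finset.erase_insert h1, ← Finset.erase_insert h2]
      exact congrArg (fun g => g.erase a) hef
    · rw [Finset.disjoint_left]
      intro e he he'
      obtain ⟨f, -, rfl⟩ := Finset.mem_image.1 he'
      exact ha ((Finset.mem_powersetCard.1 he).1 (Finset.mem_insert_self a f))

theorem six_mul_sum_powersetCard_three {α : Type*} (V : Finset α) (x : α → ℝ) :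
    6 * ∑ e ∈ V.powersetCard 3, ∏ i ∈ e, x i = (∑ i ∈ V, x i) ^ 3
      - 3 * (∑ i ∈ V, x i) * ∑ i ∈ V, x i ^ 2 + 2 * ∑ i ∈ V, x i ^ 3 := by
  classical
  induction V using Finset.induction_on with
  | empty => rw [Finset.powersetCard_eq_empty.2 (by simp)]; simp
  | insert a s ha ih =>
    rw [Finset.powersetCard_succ_insert ha, Finset.sum_union, Finset.sum_image,
      Finset.sum_insert ha, Finset.sum_insert ha, Finset.sum_insert ha]
    · have h : ∑ e ∈ s.powersetCard 2, ∏ i ∈ insert a e, x i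
          = x a * ∑ e ∈ s.powersetCard 2, ∏ i ∈ e, x i := by
        rw [Finset.mul_sum]
        refine Finset.sum_congr rfl fun e he => ?_
        rw [Finset.prod_insert fun h => ha ((Finset.mem_powersetCard.1 he).1 h)]
      rw [h]
      linear_combination ih + 3 * x a * two_mul_sum_powersetCard_two s x
    · intro e he f hf hef
      have h1 : a ∉ e := fun h => ha ((Finset.mem_powersetCard.1 he).1 h)
      have h2 : a ∉ f := fun h => ha ((Finset.mem_powersetCard.1 hf).1 h)
      rw [← Finset.erase_insert h1, ← Finset.erase_insert h2]
      exact congrArg (fun g => g.erase a) hef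
    · rw [Finset.disjoint_left]
      intro e he he'
      obtain ⟨f, -, rfl⟩ := Finset.mem_image.1 he'
      exact ha ((Finset.mem_powersetCard.1 he).1 (Finset.mem_insert_self a f))

/-- The weight of the link of `v` in the family `E`, i.e. the partial derivative of the weight
polynomial of `E` in the direction `v`. -/
noncomputable def linkWeight {α : Type*} [DecidableEq α] (E : Finset (Finset α)) (x : α → ℝ)
    (v : α) : ℝ :=
  ∑ e ∈ E with v ∈ e, ∏ i ∈ e.erase v, x i

section

variable {α : Type*} [DecidableEq α]

theorem sum_prod_shift {E : Finset (Finset α)} (hE : ∀ e ∈ E, e.card = 3) (x : α → ℝ) (v : α)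
    (δ : ℝ) :
    ∑ e ∈ E, ∏ i ∈ e, ((1 + δ) * x i - if i = v then δ else 0)
      = (1 + δ) ^ 3 * (∑ e ∈ E, ∏ i ∈ e, x i) - δ * (1 + δ) ^ 2 * linkWeight E x v := by
  unfold linkWeight
  rw [Finset.sum_filter, Finset.mul_sum, Finset.mul_sum, ← Finset.sum_sub_distrib]
  refine Finset.sum_congr rfl fun e he => ?_
  split_ifs with hv
  · have h : ∏ i ∈ e.erase v, ((1 + δ) * x i - if i = v then δ else 0)
        = (1 + δ) ^ 2 * ∏ i ∈ e.erase v, x i := by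
      rw [← (show (e.erase v).card = 2 by rw [Finset.card_erase_of_mem hv, hE e he]),
        ← Finset.prod_const, ← Finset.prod_mul_distrib]
      refine Finset.prod_congr rfl fun i hi => ?_
      rw [if_neg (Finset.ne_of_mem_erase hi), sub_zero]
    rw [← Finset.mul_prod_erase e _ hv, ← Finset.mul_prod_erase e x hv, h, if_pos rfl]
    ring
  · rw [← hE e he, ← Finset.prod_const, ← Finset.prod_mul_distrib, mul_zero, sub_zero]
    refine Finset.prod_congr rfl fun i hi => ?_
    rw [if_neg (by rintro rfl; exact hv hi), sub_zero]

/-- At a maximum of the weight polynomial, all partial derivatives in the directions of the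
support are at least `3` times the maximum. -/
theorem three_mul_le_linkWeight {E : Finset (Finset α)} (hE : ∀ e ∈ E, e.card = 3)
    {V : Finset α} {x : α → ℝ} (hx : ∀ i ∈ V, 0 ≤ x i) (hsum : ∑ i ∈ V, x i = 1)
    (hmax : ∀ y : α → ℝ, (∀ i ∈ V, 0 ≤ y i) → ∑ i ∈ V, y i = 1 →
      ∑ e ∈ E, ∏ i ∈ e, y i ≤ ∑ e ∈ E, ∏ i ∈ e, x i)
    {v : α} (hv : v ∈ V) (hxv : 0 < x v) :
    3 * ∑ e ∈ E, ∏ i ∈ e, x i ≤ linkWeight E x v := by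
  set w := ∑ e ∈ E, ∏ i ∈ e, x i
  set l := linkWeight E x v
  have key : ∀ δ : ℝ, 0 < δ → δ ≤ x v → (3 + 3 * δ + δ ^ 2) * w ≤ (1 + δ) ^ 2 * l := by
    intro δ h0 h1
    have h := hmax (fun i => (1 + δ) * x i - if i = v then δ else 0) ?_ ?_
    · rw [sum_prod_shift hE] at h
      have : δ * ((3 + 3 * δ + δ ^ 2) * w) ≤ δ * ((1 + δ) ^ 2 * l) := by
        change (1 + δ) ^ 3 * w - δ * (1 + δ) ^ 2 * l ≤ w at h
        linarith
      exact le_of_mul_le_mul_left this h0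
    · intro i hi
      have := hx i hi

      split_ifs with h
      · subst h; nlinarith
      · rw [sub_zero]; positivity
    · rw [Finset.sum_sub_distrib, ← Finset.mul_sum, hsum, Finset.sum_ite_eq' V v, if_pos hv]
      ring
  have ht1 : Filter.Tendsto (fun δ : ℝ => (3 + 3 * δ + δ ^ 2) * w) (nhdsWithin 0 (Set.Ioi 0))
      (nhds ((3 + 3 * 0 + 0 ^ 2) * w)) :=
    Filter.Tendsto.mono_left (Continuous.tendsto (by fun_prop) 0) nhdsWithin_le_nhds
  have ht2 : Filter.Tendsto (fun δ : ℝ => (1 + δ) ^ 2 * l) (nhdsWithin 0 (Set.Ioi 0))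
      (nhds ((1 + 0) ^ 2 * l)) :=
    Filter.Tendsto.mono_left (Continuous.tendsto (by fun_prop) 0) nhdsWithin_le_nhds
  have := le_of_tendsto_of_tendsto ht1 ht2 (by
    filter_upwards [Ioc_mem_nhdsGT hxv] with δ hδ using key δ hδ.1 hδ.2)
  linarith

theorem two_mul_linkWeight_le {E : Finset (Finset α)} {V : Finset α} (hE : E ⊆ V.powersetCard 3)
    {x : α → ℝ} (hx : ∀ i ∈ V, 0 ≤ x i) (hsum : ∑ i ∈ V, x i = 1) {v : α} (hv : v ∈ V) :
    2 * linkWeight E x v ≤ 1 - 2 * x v + 2 * x v ^ 2 - ∑ i ∈ V, x i ^ 2 := by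
  have h1 : linkWeight E x v ≤ ∑ e ∈ (V.erase v).powersetCard 2, ∏ i ∈ e, x i := by
    unfold linkWeight
    rw [← Finset.sum_image (s := E.filter (v ∈ ·)) (g := fun e => e.erase v)
      (f := fun e => ∏ i ∈ e, x i)]
    · refine Finset.sum_le_sum_of_subset_of_nonneg ?_ ?_
      · intro f hf
        obtain ⟨e, he, rfl⟩ := Finset.mem_image.1 hf
        obtain ⟨he, hve⟩ := Finset.mem_filter.1 he
        obtain ⟨h1, h2⟩ := Finset.mem_powersetCard.1 (hE he)
        refine Finset.mem_powersetCard.2 ⟨Finset.erase_subset_erase v h1, ?_⟩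
        rw [Finset.card_erase_of_mem hve, h2]
      · intro f hf _
        refine Finset.prod_nonneg fun i hi => hx i ?_
        exact Finset.mem_of_mem_erase ((Finset.mem_powersetCard.1 hf).1 hi)
    · intro e he f hf hef
      rw [← Finset.insert_erase (Finset.mem_filter.1 he).2,
        ← Finset.insert_erase (Finset.mem_filter.1 hf).2]
      exact congrArg (insert v) hef
  have h2 := two_mul_sum_powersetCard_two (V.erase v) x
  have h3 := Finset.add_sum_erase V x hv
  have h4 := Finset.add_sum_erase V (fun i => x i ^ 2) hv

  rw [show ∑ i ∈ V.erase v, x i = 1 - x v by linarith] at h2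
  nlinarith

theorem sum_prod_erase_sub_le_one {e : Finset α} (he : e.card = 3) {ξ : α → ℝ}
    (h0 : ∀ i ∈ e, 0 ≤ ξ i) (h1 : ∀ i ∈ e, ξ i ≤ 1) :
    ∑ v ∈ e, ∏ i ∈ e.erase v, ξ i - 2 * ∏ i ∈ e, ξ i ≤ 1 := by
  obtain ⟨a, b, c, hab, hac, hbc, rfl⟩ := Finset.card_eq_three.1 he
  have ha := h0 a (by simp)
  have hb := h0 b (by simp)
  have hc := h0 c (by simp)
  have ha' := h1 a (by simp)
  have hb' := h1 b (by simp)
  have hc' := h1 c (by simp)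
  have e1 : ({a, b, c} : Finset α).erase a = {b, c} := by
    ext i; simp; grind
  have e2 : ({a, b, c} : Finset α).erase b = {a, c} := by
    ext i; simp; grind
  have e3 : ({a, b, c} : Finset α).erase c = {a, b} := by
    ext i; simp; grind
  rw [Finset.sum_insert (by simp [hab, hac]), Finset.sum_pair hbc, e1, e2, e3,
    Finset.prod_pair hbc, Finset.prod_pair hac, Finset.prod_pair hab,
    Finset.prod_insert (by simp [hab, hac]), Finset.prod_pair hbc]
  have m1 := mul_nonneg (mul_nonneg ha hb) (sub_nonneg.2 hc')
  have m2 := mul_nonneg (mul_nonneg ha (sub_nonneg.2 hb')) (sub_nonneg.2 hc')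
  have m3 := mul_nonneg (mul_nonneg (sub_nonneg.2 ha') hb) (sub_nonneg.2 hc')
  have m4 := mul_nonneg (mul_nonneg (sub_nonneg.2 ha') (sub_nonneg.2 hb')) hc
  have m5 := mul_nonneg (mul_nonneg (sub_nonneg.2 ha') (sub_nonneg.2 hb')) (sub_nonneg.2 hc')
  nlinarith

/-- If all links have weight at least `3` times the weight of `E`, then the number of edges is
bounded below in terms of the weight, the number of vertices and the largest vertex weight. -/
theorem weight_mul_le_card {E : Finset (Finset α)} {V : Finset α} (hE : E ⊆ V.powersetCard 3)
    {x : α → ℝ} (hx : ∀ i ∈ V, 0 ≤ x i) {X : ℝ} (hX : 0 ≤ X) (hxX : ∀ i ∈ V, X * x i ≤ 1)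
    (hlink : ∀ v ∈ V, 3 * ∑ e ∈ E, ∏ i ∈ e, x i ≤ linkWeight E x v) :
    (∑ e ∈ E, ∏ i ∈ e, x i) * (X ^ 2 * (3 * V.card - 2 * X)) ≤ E.card := by
  have hcard : ∀ e ∈ E, e.card = 3 := fun e he => (Finset.mem_powersetCard.1 (hE he)).2
  have hsub : ∀ e ∈ E, e ⊆ V := fun e he => (Finset.mem_powersetCard.1 (hE he)).1
  have h1 : ∑ e ∈ E, (∑ v ∈ e, ∏ i ∈ e.erase v, X * x i - 2 * ∏ i ∈ e, X * x i) ≤ E.card := by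
    rw [Finset.card_eq_sum_ones, Nat.cast_sum, Nat.cast_one]
    refine Finset.sum_le_sum fun e he => sum_prod_erase_sub_le_one (hcard e he)
      (fun i hi => mul_nonneg hX (hx i (hsub e he hi))) fun i hi => hxX i (hsub e he hi)
  have h2 : ∑ e ∈ E, (∑ v ∈ e, ∏ i ∈ e.erase v, X * x i - 2 * ∏ i ∈ e, X * x i)
      = X ^ 2 * (∑ v ∈ V, linkWeight E x v) - 2 * X ^ 3 * ∑ e ∈ E, ∏ i ∈ e, x i := by
    have h3 : ∑ v ∈ V, linkWeight E x v = ∑ e ∈ E, ∑ v ∈ e, ∏ i ∈ e.erase v, x i := by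
      unfold linkWeight
      refine Finset.sum_comm' fun v e => ?_
      simp only [Finset.mem_filter]
      exact ⟨fun h => ⟨h.2.2, h.2.1⟩, fun h => ⟨hsub e h.2 h.1, h.2, h.1⟩⟩
    rw [h3, Finset.mul_sum, Finset.mul_sum, ← Finset.sum_sub_distrib]
    refine Finset.sum_congr rfl fun e he => ?_
    rw [Finset.prod_mul_distrib, Finset.prod_const, hcard e he, Finset.mul_sum]
    congr 1
    · refine Finset.sum_congr rfl fun v hv => ?_
      rw [Finset.prod_mul_distrib, Finset.prod_const, Finset.card_erase_of_mem hv, hcard e he]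
    · ring
  have h3 : (V.card : ℝ) * (3 * ∑ e ∈ E, ∏ i ∈ e, x i) ≤ ∑ v ∈ V, linkWeight E x v := by
    rw [← nsmul_eq_mul]
    exact Finset.card_nsmul_le_sum _ _ _ hlink
  have h4 := mul_le_mul_of_nonneg_left h3 (sq_nonneg X)
  rw [h2] at h1
  linarith

end

/-- Numerical core of the bound on the size of the support. -/
theorem support_bound_numeric {n k X : ℝ} (hn : 1000 ≤ n) (hk : n + 2 ≤ k) (hX : 2 ≤ X)
    (hXk : X ≤ k) (h1 : 2 / X - 2 / X ^ 2 + 1 / k ≤ 3 / n - 2 / n ^ 2)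
    (h2 : X ^ 2 * (3 * k - 2 * X) ≤ n ^ 2 * (n + 3)) : False := by
  have hn0 : 0 < n := by linarith
  have hk0 : 0 < k := by linarith
  have hX0 : 0 < X := by linarith
  have hXn : X < n := by
    by_contra! h
    have : 0 ≤ (X - n) * (3 * k * (X + n) - 2 * (X ^ 2 + X * n + n ^ 2)) := by
      refine mul_nonneg (by linarith) ?_
      nlinarith [mul_nonneg (sub_nonneg.2 h) (sub_nonneg.2 hXk)]
    nlinarith [sq_nonneg n, mul_pos hn0 hn0]
  have hX6 : 6 / 10 * n ≤ X := by
    by_contra! h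
    have e1 : 2 / X ^ 2 ≤ 1 / X * (2 / X) := by
      apply le_of_eq; field_simp
    have e2 : 0 < 1 / k := by positivity
    have e3 : 0 < 2 / n ^ 2 := by positivity
    have e4 : 2 / X - 2 / X ^ 2 < 3 / n := by linarith
    have e5 : 2 * (X - 1) * n < 3 * X ^ 2 := by
      have : 2 / X - 2 / X ^ 2 = 2 * (X - 1) / X ^ 2 := by field_simp
      rw [this, div_lt_div_iff₀ (by positivity) hn0] at e4
      linarith
    by_cases hb : X ≤ 10
    · nlinarith
    · push Not at hb
      nlinarith
  -- the deficit `n - X`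
  have hθ : (n - X) * k ≤ 51 / 100 * ((k - n) * X) := by
    have e1 : (1 / X - 1 / n) * (2 - 2 / X - 2 / n) ≤ 1 / n - 1 / k := by
      have : (1 / X - 1 / n) * (2 - 2 / X - 2 / n)
          = 2 / X - 2 / n - (2 / X ^ 2 - 2 / n ^ 2) := by field_simp; ring
      rw [this]
      have : 3 / n = 2 / n + 1 / n := by ring
      linarith
    have e2 : (1960 / 1000 : ℝ) ≤ 2 - 2 / X - 2 / n := by
      have : 2 / X ≤ 1 / 100 := by
        rw [div_le_div_iff₀ hX0 (by norm_num)]; nlinarith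
      have : 2 / n ≤ 1 / 100 := by
        rw [div_le_div_iff₀ hn0 (by norm_num)]; nlinarith
      linarith
    have e3 : 1 / X - 1 / n = (n - X) / (X * n) := by field_simp
    have e4 : 1 / n - 1 / k = (k - n) / (n * k) := by field_simp
    have e5 : (n - X) / (X * n) * (1960 / 1000) ≤ (k - n) / (n * k) := by
      rw [← e3, ← e4]
      refine le_trans (mul_le_mul_of_nonneg_left e2 ?_) e1
      rw [e3]
      exact div_nonneg (by linarith) (by positivity)
    rw [div_mul_eq_mul_div, div_le_div_iff₀ (by positivity) (by positivity)] at e5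
    have e6 : n * ((n - X) * (1960 / 1000) * k) ≤ n * ((k - n) * X) := by linarith
    have e7 := le_of_mul_le_mul_left e6 hn0
    nlinarith [mul_nonneg (show (0 : ℝ) ≤ k - n by linarith) hX0.le]
  by_cases hk2 : 2 * n ≤ k
  · have e1 : X ^ 2 * (6 * n - 2 * X) ≤ n ^ 2 * (n + 3) := by
      refine le_trans (mul_le_mul_of_nonneg_left ?_ (sq_nonneg X)) h2
      linarith
    have e2 : (6 / 10 * n) ^ 2 * (4 * n) ≤ X ^ 2 * (6 * n - 2 * X) := by
      apply mul_le_mul _ (by linarith) (by positivity) (by positivity)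
      exact pow_le_pow_left₀ (by positivity) hX6 2
    nlinarith [mul_pos hn0 hn0, mul_pos (mul_pos hn0 hn0) hn0]
  · push Not at hk2
    -- write `J = k - n`, `θ = n - X`
    obtain ⟨J, rfl⟩ : ∃ J, k = n + J := ⟨k - n, by ring⟩
    obtain ⟨θ, rfl⟩ : ∃ θ, X = n - θ := ⟨n - X, by ring⟩
    have hJ : 2 ≤ J := by linarith
    have hθ0 : 0 < θ := by linarith
    have hθ' : θ * (n + J) ≤ 51 / 100 * (J * (n - θ)) := by
      have := hθ
      ring_nf at this ⊢
      linarith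
    have hθn : θ * n ≤ 51 / 100 * (J * (n - θ)) := by
      nlinarith [mul_pos hθ0 (show 0 < J by linarith)]
    have hθX : θ ≤ 255 / 1000 * (n - θ) := by
      have : 2 * J * θ ≤ J * (51 / 100 * (n - θ)) := by
        nlinarith [mul_nonneg hθ0.le (show 0 ≤ n - J by linarith)]
      have : J * (2 * θ) ≤ J * (51 / 100 * (n - θ)) := by linarith
      have := le_of_mul_le_mul_left this (by linarith)
      linarith
    have e1 : 3 * J * (n - θ) ^ 2 + 2 * θ ^ 3 ≤ 3 * n ^ 2 + 3 * n * θ ^ 2 := by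
      nlinarith
    have e2 : n * θ ^ 2 ≤ 51 / 100 * θ * (J * (n - θ)) := by
      nlinarith
    have e3 : J * ((n - θ) * ((n - θ) - 51 / 100 * θ)) ≤ n ^ 2 := by
      linarith [pow_pos hθ0 3]
    have e4 : 869 / 1000 * (n - θ) ^ 2 ≤ (n - θ) * ((n - θ) - 51 / 100 * θ) := by
      nlinarith
    have e5 : 2 * (869 / 1000 * (n - θ) ^ 2) ≤ n ^ 2 := by
      nlinarith [sq_nonneg (n - θ)]
    have e6 : n ≤ 1255 / 1000 * (n - θ) := by linarith
    have e7 := pow_le_pow_left₀ hn0.le e6 2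
    have e8 : 0 < (n - θ) ^ 2 := by positivity
    clear hθ hθ' hθn hθX e1 e2 e3 e4 h1 h2
    linarith

/-- Numerical core of the bound on the largest weight. -/
theorem max_weight_numeric {n x : ℝ} (hn : 10 ≤ n) (hx : x ≤ 1 / 2)
    (h1 : 2 * x - 2 * x ^ 2 + 1 / (n + 1) ≤ 3 / n - 2 / n ^ 2) : n * x ≤ 1 + 2 / n := by
  have hn0 : 0 < n := by linarith
  by_contra! h
  have hz : x > 1 / n + 2 / n ^ 2 := by
    have : n * (1 / n + 2 / n ^ 2) < n * x := by
      have : n * (1 / n + 2 / n ^ 2) = 1 + 2 / n := by field_simp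
      linarith
    exact lt_of_mul_lt_mul_left this hn0.le
  set d := 1 / n with hd
  have hd0 : 0 < d := by positivity
  have hd1 : d ≤ 1 / 10 := by
    rw [hd, div_le_div_iff₀ hn0 (by norm_num)]; linarith
  have e1 : 2 / n ^ 2 = 2 * d ^ 2 := by rw [hd]; field_simp
  have e2 : 3 / n = 3 * d := by rw [hd]; field_simp
  have e3 : d - d ^ 2 ≤ 1 / (n + 1) := by
    rw [le_div_iff₀ (by linarith)]
    have : d * n = 1 := by rw [hd]; field_simp
    nlinarith [pow_pos hd0 2]
  rw [e1] at hz
  rw [e1, e2] at h1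
  have e4 : (d + 2 * d ^ 2) - (d + 2 * d ^ 2) ^ 2 ≤ x - x ^ 2 := by nlinarith
  nlinarith [pow_pos hd0 2, pow_pos hd0 3]

/-- The final estimate when the second lightest vertex is light. -/
theorem light_numeric {N e a z r : ℝ} (hN : 200 ≤ N) (he0 : 0 ≤ e) (he : e ≤ N + 6)
    (hz0 : 0 ≤ z) (hz : z ≤ 2) (hr : N ≤ r ^ 2) (hr0 : 0 ≤ r) (hv : 40 * r ≤ N * (1 - a)) :
    a * z * e - z * e + z ^ 2 * (e ^ 2 + 64 * e) / (2 * N) - N / 2 * (1 - a - z) ^ 2 ≤ 0 := by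
  have hN0 : 0 < N := by linarith
  have key : 0 ≤ (N * (1 - a) - z * (N - e)) ^ 2 + 2 * z ^ 2 * e * (N - e - 32) := by
    by_cases h : e ≤ N - 32
    · have : 0 ≤ 2 * z ^ 2 * e * (N - e - 32) := mul_nonneg (by positivity) (by linarith)
      positivity
    · push Not at h
      have hr1 : 14 ≤ r := by nlinarith
      have e1 : 20 * r ≤ N * (1 - a) - z * (N - e) := by nlinarith
      have e2 : (20 * r) ^ 2 ≤ (N * (1 - a) - z * (N - e)) ^ 2 :=
        pow_le_pow_left₀ (by positivity) e1 2
      have e3 : 2 * z ^ 2 * e * (32 + e - N) ≤ 2 * 4 * (N + 6) * 38 := by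
        have : z ^ 2 ≤ 4 := by nlinarith
        have a1 : 2 * z ^ 2 * e ≤ 2 * 4 * (N + 6) := by nlinarith
        exact mul_le_mul a1 (by linarith) (by linarith) (by linarith)
      nlinarith
  have : a * z * e - z * e + z ^ 2 * (e ^ 2 + 64 * e) / (2 * N) - N / 2 * (1 - a - z) ^ 2
      = -(((N * (1 - a) - z * (N - e)) ^ 2 + 2 * z ^ 2 * e * (N - e - 32)) / (2 * N)) := by
    field_simp
    ring
  rw [this]
  exact neg_nonpos.2 (div_nonneg key (by positivity))

section

variable {α : Type*} [DecidableEq α]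

/-- Coefficients of a linear lower bound for the weight of the triple `A`: full weight on the two
elements of `A ∩ R`, or weight `2 / 3` on the three elements of `A` if `A ⊆ R`. -/
noncomputable def traceCoeff (R A : Finset α) (i : α) : ℝ :=
  if i ∈ A then (if A ⊆ R then 2 / 3 else 1) else 0

theorem sum_traceCoeff_mul (R A B : Finset α) :
    ∑ i ∈ R, traceCoeff R A i * traceCoeff R B i
      = (if A ⊆ R then 2 / 3 else 1) * (if B ⊆ R then 2 / 3 else 1) * ((R ∩ A) ∩ (R ∩ B)).card := by
  have : (R ∩ A) ∩ (R ∩ B) = R.filter fun i => i ∈ A ∧ i ∈ B := by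
    ext i; simp only [Finset.mem_inter, Finset.mem_filter]; tauto
  rw [this, Finset.card_filter, Nat.cast_sum, Finset.mul_sum]
  refine Finset.sum_congr rfl fun i _ => ?_
  unfold traceCoeff
  by_cases h1 : i ∈ A <;> by_cases h2 : i ∈ B <;> simp [h1, h2]

theorem sum_traceCoeff_mul_le {R A B : Finset α} (hA : A.card = 3) (hB : B.card = 3)
    (hA' : ¬ A ⊆ R → (R ∩ A).card = 2) (hB' : ¬ B ⊆ R → (R ∩ B).card = 2) :
    ∑ i ∈ R, traceCoeff R A i * traceCoeff R B i
      ≤ 1 + (if R ∩ B ⊆ A then 1 else 0) + (if R ∩ A ⊆ B then 1 else 0) := by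
  rw [sum_traceCoeff_mul]
  have hA3 : A ⊆ R → (R ∩ A).card = 3 := fun h => by rw [Finset.inter_eq_right.2 h, hA]
  have hB3 : B ⊆ R → (R ∩ B).card = 3 := fun h => by rw [Finset.inter_eq_right.2 h, hB]
  have l1 : ((R ∩ A) ∩ (R ∩ B)).card ≤ (R ∩ A).card := Finset.card_le_card Finset.inter_subset_left
  have l2 : ((R ∩ A) ∩ (R ∩ B)).card ≤ (R ∩ B).card := Finset.card_le_card Finset.inter_subset_right
  have s1 : (R ∩ A).card ≤ ((R ∩ A) ∩ (R ∩ B)).card → R ∩ A ⊆ B := fun h =>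
    (Finset.inter_eq_left.1 (Finset.eq_of_subset_of_card_le Finset.inter_subset_left h)).trans
      Finset.inter_subset_right
  have s2 : (R ∩ B).card ≤ ((R ∩ A) ∩ (R ∩ B)).card → R ∩ B ⊆ A := fun h =>
    (Finset.inter_eq_right.1 (Finset.eq_of_subset_of_card_le Finset.inter_subset_right h)).trans
      Finset.inter_subset_right
  generalize ((R ∩ A) ∩ (R ∩ B)).card = r at *
  have key : ∀ q : ℕ, r ≤ q → (r : ℝ) ≤ q := fun q h => by exact_mod_cast h
  have p1 : (0 : ℝ) ≤ if R ∩ B ⊆ A then 1 else 0 := by split_ifs <;> norm_num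
  have p2 : (0 : ℝ) ≤ if R ∩ A ⊆ B then 1 else 0 := by split_ifs <;> norm_num
  by_cases hAR : A ⊆ R <;> by_cases hBR : B ⊆ R
  · rw [if_pos hAR, if_pos hBR]
    rw [hA3 hAR] at l1 s1
    by_cases h : r ≤ 2
    · have := key 2 h
      push_cast at this
      linarith
    · rw [if_pos (s1 (by omega))]
      have := key 3 l1
      push_cast at this
      linarith
  · rw [if_pos hAR, if_neg hBR]
    rw [hB' hBR] at l2 s2
    by_cases h : r ≤ 1
    · have := key 1 h
      push_cast at this
      linarith
    · rw [if_pos (s2 (by omega))]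
      have := key 2 l2
      push_cast at this
      linarith
  · rw [if_neg hAR, if_pos hBR]
    rw [hA' hAR] at l1 s1
    by_cases h : r ≤ 1
    · have := key 1 h
      push_cast at this
      linarith
    · rw [if_pos (s1 (by omega))]
      have := key 2 l1
      push_cast at this
      linarith
  · rw [if_neg hAR, if_neg hBR]
    rw [hA' hAR] at l1 s1
    by_cases h : r ≤ 1
    · have := key 1 h
      push_cast at this
      linarith
    · rw [if_pos (s1 (by omega))]
      have := key 2 l1
      push_cast at this
      linarith

/-- The square sum of the fractional degrees of a family of triples, none of which contains both
elements `p` and `q` outside `R`. -/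
theorem sum_sq_sum_traceCoeff_le {R : Finset α} {p q : α} {N : Finset (Finset α)}
    (hcard : ∀ A ∈ N, A.card = 3) (hsub : ∀ A ∈ N, A ⊆ insert p (insert q R))
    (htrace : ∀ A ∈ N, ¬ A ⊆ R → (R ∩ A).card = 2) :
    ∑ i ∈ R, (∑ A ∈ N, traceCoeff R A i) ^ 2 ≤ (N.card : ℝ) ^ 2 + 64 * N.card := by
  have h1 : ∑ i ∈ R, (∑ A ∈ N, traceCoeff R A i) ^ 2
      = ∑ A ∈ N, ∑ B ∈ N, ∑ i ∈ R, traceCoeff R A i * traceCoeff R B i := by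
    simp_rw [sq, Finset.sum_mul_sum]
    rw [Finset.sum_comm]
    exact Finset.sum_congr rfl fun A _ => Finset.sum_comm
  have h2 : ∀ A ∈ N, ∑ B ∈ N, (if R ∩ B ⊆ A then (1 : ℝ) else 0) ≤ 32 := by
    intro A hA
    rw [← Finset.sum_filter, Finset.sum_const, nsmul_eq_mul, mul_one]
    have s1 : N.filter (fun B => R ∩ B ⊆ A) ⊆ (insert p (insert q A)).powerset := by
      intro B hB
      obtain ⟨hB, hBA⟩ := Finset.mem_filter.1 hB
      refine Finset.mem_powerset.2 fun i hi => ?_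
      have h3 := hsub B hB hi
      simp only [Finset.mem_insert] at h3 ⊢
      rcases h3 with h3 | h3 | h3
      · exact Or.inl h3
      · exact Or.inr (Or.inl h3)
      · exact Or.inr (Or.inr (hBA (Finset.mem_inter.2 ⟨h3, hi⟩)))
    have s2 := Finset.card_le_card s1
    rw [Finset.card_powerset] at s2
    have s3 : (insert p (insert q A)).card ≤ 5 := by
      have := Finset.card_insert_le p (insert q A)
      have := Finset.card_insert_le q A
      have := hcard A hA
      omega
    have s4 : (N.filter (fun B => R ∩ B ⊆ A)).card ≤ 2 ^ 5 :=
      s2.trans (Nat.pow_le_pow_right (by norm_num) s3)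
    exact_mod_cast s4
  have h3 : ∑ A ∈ N, ∑ B ∈ N, (if R ∩ B ⊆ A then (1 : ℝ) else 0) ≤ 32 * N.card := by
    refine (Finset.sum_le_card_nsmul N _ 32 h2).trans (le_of_eq ?_)
    rw [nsmul_eq_mul, mul_comm]
  have h4 : ∑ A ∈ N, ∑ B ∈ N, (if R ∩ A ⊆ B then (1 : ℝ) else 0) ≤ 32 * N.card := by
    rw [Finset.sum_comm]
    exact h3
  rw [h1]
  calc ∑ A ∈ N, ∑ B ∈ N, ∑ i ∈ R, traceCoeff R A i * traceCoeff R B i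
      ≤ ∑ A ∈ N, ∑ B ∈ N, ((1 : ℝ) + (if R ∩ B ⊆ A then 1 else 0)
          + (if R ∩ A ⊆ B then 1 else 0)) :=
        Finset.sum_le_sum fun A hA => Finset.sum_le_sum fun B hB =>
          sum_traceCoeff_mul_le (hcard A hA) (hcard B hB) (htrace A hA) (htrace B hB)
    _ = (N.card : ℝ) ^ 2 + ∑ A ∈ N, ∑ B ∈ N, (if R ∩ B ⊆ A then (1 : ℝ) else 0)
          + ∑ A ∈ N, ∑ B ∈ N, (if R ∩ A ⊆ B then (1 : ℝ) else 0) := by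
        simp only [Finset.sum_add_distrib, Finset.sum_const, nsmul_eq_mul]
        ring
    _ ≤ _ := by linarith

theorem triple_cases {R : Finset α} {p q : α} {A : Finset α} (hA : A.card = 3)
    (hAR : A ⊆ insert p (insert q R)) (hpq : ¬ (p ∈ A ∧ q ∈ A)) :
    A ⊆ R ∨ ∃ w i j, (w = p ∨ w = q) ∧ i ∈ R ∧ j ∈ R ∧ i ≠ j ∧ w ≠ i ∧ w ≠ j ∧ A = {w, i, j} := by
  by_cases h : A ⊆ R
  · exact Or.inl h
  right
  obtain ⟨w, hw, hwR⟩ := Finset.not_subset.1 h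
  have hwpq : w = p ∨ w = q := by
    have := hAR hw
    simp only [Finset.mem_insert] at this
    tauto
  have hc : (A.erase w).card = 2 := by rw [Finset.card_erase_of_mem hw, hA]
  obtain ⟨i, j, hij, hij'⟩ := Finset.card_eq_two.1 hc
  have hmem : ∀ l ∈ A.erase w, l ∈ R := by
    intro l hl
    obtain ⟨h1, h2⟩ := Finset.mem_erase.1 hl
    have h3 := hAR h2
    simp only [Finset.mem_insert] at h3
    rcases hwpq with rfl | rfl <;> rcases h3 with rfl | rfl | h3 <;> tauto
  have hi : i ∈ A.erase w := by rw [hij']; simp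
  have hj : j ∈ A.erase w := by rw [hij']; simp
  refine ⟨w, i, j, hwpq, hmem i hi, hmem j hj, hij, ?_, ?_, ?_⟩
  · exact (Finset.ne_of_mem_erase hi).symm
  · exact (Finset.ne_of_mem_erase hj).symm
  · rw [← hij', Finset.insert_erase hw]

theorem one_sub_sub_le_mul {s t d e : ℝ} (hs : 0 ≤ s) (ht : 0 ≤ t) (hd : 0 ≤ d) (he : 0 ≤ e)
    (hsd : 1 - d ≤ s) (hte : 1 - e ≤ t) : 1 - d - e ≤ s * t := by
  by_cases h : d ≤ 1
  · by_cases h' : e ≤ 1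
    · nlinarith [mul_le_mul hsd hte (by linarith) hs, mul_nonneg hd he]
    · nlinarith [mul_nonneg hs ht]
  · nlinarith [mul_nonneg hs ht]

/-- A linear lower bound for the weight of a triple. -/
theorem mul_one_sub_le_prod {R : Finset α} {p q : α} (hpR : p ∉ R) (hqR : q ∉ R)
    {ξ D : α → ℝ} {z : ℝ} (hz : 0 ≤ z) (hξ : ∀ i ∈ insert p (insert q R), z ≤ ξ i)
    (hD : ∀ i ∈ R, 0 ≤ D i) (hξD : ∀ i ∈ R, 1 - D i ≤ ξ i)
    {A : Finset α} (hA : A.card = 3) (hAR : A ⊆ insert p (insert q R)) (hpq : ¬ (p ∈ A ∧ q ∈ A)) :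
    z * (1 - ∑ i ∈ R, traceCoeff R A i * D i) ≤ ∏ i ∈ A, ξ i := by
  have hRsub : R ⊆ insert p (insert q R) := fun i hi => by simp [hi]
  have h0 : ∀ i ∈ insert p (insert q R), 0 ≤ ξ i := fun i hi => hz.trans (hξ i hi)
  have hpair : ∀ i ∈ R, ∀ j ∈ R, 1 - D i - D j ≤ ξ i * ξ j := fun i hi j hj =>
    one_sub_sub_le_mul (h0 i (hRsub hi)) (h0 j (hRsub hj)) (hD i hi) (hD j hj) (hξD i hi)
      (hξD j hj)
  have htriple : ∀ w ∈ insert p (insert q R), ∀ i ∈ R, ∀ j ∈ R,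
      z * (1 - D i - D j) ≤ ξ w * (ξ i * ξ j) := fun w hw i hi j hj =>
    (mul_le_mul_of_nonneg_left (hpair i hi j hj) hz).trans
      (mul_le_mul_of_nonneg_right (hξ w hw) (mul_nonneg (h0 i (hRsub hi)) (h0 j (hRsub hj))))
  have hsum : ∑ i ∈ R, traceCoeff R A i * D i
      = (if A ⊆ R then 2 / 3 else 1) * ∑ i ∈ R ∩ A, D i := by
    rw [← Finset.filter_mem_eq_inter, Finset.sum_filter, Finset.mul_sum]
    refine Finset.sum_congr rfl fun i _ => ?_
    unfold traceCoeff
    by_cases h1 : i ∈ A <;> simp [h1]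
  rw [hsum]
  rcases triple_cases hA hAR hpq with h | ⟨w, i, j, hw, hi, hj, hij, hwi, hwj, rfl⟩
  · rw [if_pos h, Finset.inter_eq_right.2 h]
    obtain ⟨a, b, c, hab, hac, hbc, rfl⟩ := Finset.card_eq_three.1 hA
    have ha : a ∈ R := h (by simp)
    have hb : b ∈ R := h (by simp)
    have hc : c ∈ R := h (by simp)
    rw [Finset.sum_insert (by simp [hab, hac]), Finset.sum_pair hbc,
      Finset.prod_insert (by simp [hab, hac]), Finset.prod_pair hbc]
    have t1 := htriple a (hRsub ha) b hb c hc
    have t2 := htriple b (hRsub hb) a ha c hc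
    have t3 := htriple c (hRsub hc) a ha b hb
    linarith
  · have hwR : w ∉ R := by rcases hw with rfl | rfl <;> assumption
    have hw' : w ∈ insert p (insert q R) := by rcases hw with rfl | rfl <;> simp
    have hn : ¬ ({w, i, j} : Finset α) ⊆ R := fun h => hwR (h (by simp))
    have hint : R ∩ {w, i, j} = {i, j} := by
      ext l
      simp only [Finset.mem_inter, Finset.mem_insert, Finset.mem_singleton]
      constructor
      · rintro ⟨h1, rfl | h2⟩
        · exact absurd h1 hwR
        · exact h2
      · rintro (rfl | rfl)
        · exact ⟨hi, by simp⟩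
        · exact ⟨hj, by simp⟩
    rw [if_neg hn, hint, Finset.sum_pair hij, Finset.prod_insert (by simp [hwi, hwj]),
      Finset.prod_pair hij]
    have := htriple w hw' i hi j hj
    linarith

theorem card_inter_eq_two {R : Finset α} {p q : α} (hpR : p ∉ R) (hqR : q ∉ R) {A : Finset α}
    (hA : A.card = 3) (hAR : A ⊆ insert p (insert q R)) (hpq : ¬ (p ∈ A ∧ q ∈ A))
    (hn : ¬ A ⊆ R) : (R ∩ A).card = 2 := by
  rcases triple_cases hA hAR hpq with h | ⟨w, i, j, hw, hi, hj, hij, hwi, hwj, rfl⟩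
  · exact absurd h hn
  · have hwR : w ∉ R := by rcases hw with rfl | rfl <;> assumption
    rw [Finset.inter_insert_of_notMem hwR, Finset.inter_eq_right.2, Finset.card_pair hij]
    intro l hl
    rcases Finset.mem_insert.1 hl with rfl | hl
    · exact hi
    · rw [Finset.mem_singleton.1 hl]; exact hj

/-- A lower bound for the total weight of a family of triples, none of which contains both
elements outside `R`. -/
theorem sum_prod_ge {R : Finset α} {p q : α} (hpR : p ∉ R) (hqR : q ∉ R)
    {ξ D : α → ℝ} {z κ : ℝ} (hκ : 0 < κ) (hz : 0 ≤ z) (hξ : ∀ i ∈ insert p (insert q R), z ≤ ξ i)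
    (hD : ∀ i ∈ R, 0 ≤ D i) (hξD : ∀ i ∈ R, 1 - D i ≤ ξ i) {N : Finset (Finset α)}
    (hcard : ∀ A ∈ N, A.card = 3) (hsub : ∀ A ∈ N, A ⊆ insert p (insert q R))
    (hpq : ∀ A ∈ N, ¬ (p ∈ A ∧ q ∈ A)) :
    z * N.card - z ^ 2 * ((N.card : ℝ) ^ 2 + 64 * N.card) / (2 * κ)
      ≤ ∑ A ∈ N, ∏ i ∈ A, ξ i + κ / 2 * ∑ i ∈ R, D i ^ 2 := by
  have h1 : ∑ A ∈ N, z * (1 - ∑ i ∈ R, traceCoeff R A i * D i) ≤ ∑ A ∈ N, ∏ i ∈ A, ξ i :=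
    Finset.sum_le_sum fun A hA =>
      mul_one_sub_le_prod hpR hqR hz hξ hD hξD (hcard A hA) (hsub A hA) (hpq A hA)
  have h2 : ∑ A ∈ N, z * (1 - ∑ i ∈ R, traceCoeff R A i * D i)
      = z * N.card - ∑ i ∈ R, z * (∑ A ∈ N, traceCoeff R A i) * D i := by
    rw [← Finset.mul_sum, Finset.sum_sub_distrib, Finset.sum_comm]
    simp only [Finset.sum_const, nsmul_eq_mul, mul_one, ← Finset.sum_mul, mul_sub]
    rw [Finset.mul_sum]
    simp only [mul_assoc]
  have h3 : ∑ i ∈ R, z * (∑ A ∈ N, traceCoeff R A i) * D i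
      ≤ ∑ i ∈ R, (z ^ 2 / (2 * κ) * (∑ A ∈ N, traceCoeff R A i) ^ 2 + κ / 2 * D i ^ 2) := by
    refine Finset.sum_le_sum fun i _ => ?_
    generalize ∑ A ∈ N, traceCoeff R A i = d
    have : z ^ 2 / (2 * κ) * d ^ 2 + κ / 2 * D i ^ 2 - z * d * D i
        = (z * d - κ * D i) ^ 2 / (2 * κ) := by
      field_simp
      ring
    have : 0 ≤ (z * d - κ * D i) ^ 2 / (2 * κ) := by positivity
    linarith
  rw [Finset.sum_add_distrib, ← Finset.mul_sum, ← Finset.mul_sum] at h3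
  have h4 := sum_sq_sum_traceCoeff_le hcard hsub fun A hA =>
    card_inter_eq_two hpR hqR (hcard A hA) (hsub A hA) (hpq A hA)
  have h5 := mul_le_mul_of_nonneg_left h4 (show 0 ≤ z ^ 2 / (2 * κ) by positivity)
  have h6 : z ^ 2 / (2 * κ) * ((N.card : ℝ) ^ 2 + 64 * N.card)
      = z ^ 2 * ((N.card : ℝ) ^ 2 + 64 * N.card) / (2 * κ) := by ring
  linarith

end

section

variable {α : Type*} [DecidableEq α]

/-- An upper bound for the weight of the complete `3`-graph on `n + 1` vertices, in which the
vertices `p` and `q` are compared with a single vertex. -/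
theorem sum_powersetCard_three_le {R : Finset α} {p q : α} (hpq : p ≠ q) (hpR : p ∉ R)
    (hqR : q ∉ R) {n : ℝ} (hR : (R.card : ℝ) = n - 1) {ξ : α → ℝ}
    (hsum : ∑ i ∈ insert p (insert q R), ξ i = n) (h3 : ∀ i ∈ R, ξ i ≤ 3)
    (h3' : ξ p + ξ q ≤ 3) :
    ∑ e ∈ (insert p (insert q R)).powersetCard 3, ∏ i ∈ e, ξ i
      ≤ n * (n - 1) * (n - 2) / 6
        - (n - 4) / 2 * (∑ i ∈ R, (ξ i - 1) ^ 2 + (ξ p + ξ q - 1) ^ 2)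
        + ξ p * ξ q * ∑ i ∈ R, ξ i := by
  have hp : p ∉ insert q R := by simp [hpq, hpR]
  have h6 := six_mul_sum_powersetCard_three (insert p (insert q R)) ξ
  rw [hsum, Finset.sum_insert hp, Finset.sum_insert hqR, Finset.sum_insert hp,
    Finset.sum_insert hqR] at h6
  rw [Finset.sum_insert hp, Finset.sum_insert hqR] at hsum
  have t2 : ∑ i ∈ R, (ξ i - 1) ^ 2 = ∑ i ∈ R, ξ i ^ 2 - 2 * ∑ i ∈ R, ξ i + (n - 1) := by
    rw [Finset.mul_sum, ← Finset.sum_sub_distrib, ← hR, Finset.card_eq_sum_ones, Nat.cast_sum,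
      ← Finset.sum_add_distrib]
    refine Finset.sum_congr rfl fun i _ => ?_
    push_cast
    ring
  have t3 : ∑ i ∈ R, (ξ i - 1) ^ 3
      = ∑ i ∈ R, ξ i ^ 3 - 3 * ∑ i ∈ R, ξ i ^ 2 + 3 * ∑ i ∈ R, ξ i - (n - 1) := by
    rw [Finset.mul_sum, Finset.mul_sum, ← Finset.sum_sub_distrib, ← hR, Finset.card_eq_sum_ones,
      Nat.cast_sum, ← Finset.sum_add_distrib, ← Finset.sum_sub_distrib]
    refine Finset.sum_congr rfl fun i _ => ?_
    push_cast
    ring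
  have t4 : ∑ i ∈ R, (ξ i - 1) ^ 3 ≤ 2 * ∑ i ∈ R, (ξ i - 1) ^ 2 := by
    rw [Finset.mul_sum]
    refine Finset.sum_le_sum fun i hi => ?_
    have := mul_nonneg (sub_nonneg.2 (h3 i hi)) (sq_nonneg (ξ i - 1))
    nlinarith
  have t5 : (ξ p + ξ q - 1) ^ 3 ≤ 2 * (ξ p + ξ q - 1) ^ 2 := by
    have := mul_nonneg (sub_nonneg.2 h3') (sq_nonneg (ξ p + ξ q - 1))
    nlinarith
  have t6 : 0 ≤ ∑ i ∈ R, (ξ i - 1) ^ 2 := Finset.sum_nonneg fun i _ => sq_nonneg _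
  have t7 := sq_nonneg (ξ p + ξ q - 1)
  rw [t3, t2] at t4
  rw [t2] at t6 ⊢
  generalize ∑ i ∈ R, ξ i ^ 3 = S3 at *
  generalize ∑ i ∈ R, ξ i ^ 2 = S2 at *
  have hS1 : ∑ i ∈ R, ξ i = n - ξ p - ξ q := by linarith
  rw [hS1] at t4 t6 ⊢
  linarith

/-- The weight of the missing triples containing both `p` and `q`. -/
theorem sum_missing_pair {R : Finset α} {p q : α} (hpq : p ≠ q) (hpR : p ∉ R) (hqR : q ∉ R)
    (E : Finset (Finset α)) (f : Finset α → ℝ) :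
    ∑ A ∈ ((insert p (insert q R)).powersetCard 3 \ E).filter (fun A => p ∈ A ∧ q ∈ A), f A
      = ∑ i ∈ R.filter (fun i => {p, q, i} ∉ E), f {p, q, i} := by
  have hinj : ∀ i ∈ R, ∀ j ∈ R, ({p, q, i} : Finset α) = {p, q, j} → i = j := by
    intro i hi j hj h
    have : i ∈ ({p, q, j} : Finset α) := by rw [← h]; simp
    simp only [Finset.mem_insert, Finset.mem_singleton] at this
    rcases this with rfl | rfl | h
    · exact absurd hi hpR
    · exact absurd hi hqR
    · exact h
  have himage : ((insert p (insert q R)).powersetCard 3 \ E).filter (fun A => p ∈ A ∧ q ∈ A)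
      = (R.filter (fun i => {p, q, i} ∉ E)).image fun i => {p, q, i} := by
    ext A
    simp only [Finset.mem_filter, Finset.mem_sdiff, Finset.mem_powersetCard, Finset.mem_image]
    constructor
    · rintro ⟨⟨⟨hA, hc⟩, hE⟩, hp, hq⟩
      have hc1 : ((A.erase p).erase q).card = 1 := by
        rw [Finset.card_erase_of_mem (Finset.mem_erase.2 ⟨hpq.symm, hq⟩),
          Finset.card_erase_of_mem hp, hc]
      obtain ⟨i, hi⟩ := Finset.card_eq_one.1 hc1
      have hAi : {p, q, i} = A := by
        rw [← Finset.insert_erase hp, ← Finset.insert_erase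
          (Finset.mem_erase.2 ⟨hpq.symm, hq⟩), hi]
      have hi' : i ∈ (A.erase p).erase q := by rw [hi]; simp
      simp only [Finset.mem_erase] at hi'
      have hiR := hA hi'.2.2
      simp only [Finset.mem_insert] at hiR
      refine ⟨i, ⟨by tauto, hAi ▸ hE⟩, hAi⟩
    · rintro ⟨i, ⟨hi, hE⟩, rfl⟩
      refine ⟨⟨⟨?_, ?_⟩, hE⟩, by simp, by simp⟩
      · intro j hj
        simp only [Finset.mem_insert, Finset.mem_singleton] at hj ⊢
        rcases hj with rfl | rfl | rfl <;> simp [hi]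
      · refine Finset.card_eq_three.2 ⟨p, q, i, hpq, ?_, ?_, rfl⟩
        · rintro rfl; exact hpR hi
        · rintro rfl; exact hqR hi
  rw [himage, Finset.sum_image]
  intro i hi j hj h
  exact hinj i (Finset.mem_filter.1 hi).1 j (Finset.mem_filter.1 hj).1 h

set_option maxHeartbeats 1000000 in
/-- A `3`-graph on `n + 1` vertices with sufficiently many missing triples, all of whose weights
are about the average or below: its weight is at most that of a complete `3`-graph on `n`
vertices. The weights are scaled to have sum `n`. -/
theorem sum_prod_le_of_card_eq_insert {R : Finset α} {p q : α} (hpq : p ≠ q) (hpR : p ∉ R)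
    (hqR : q ∉ R) {n : ℝ} (hn : 30000 ≤ n) (hR : (R.card : ℝ) = n - 1) {ξ : α → ℝ}
    (hsum : ∑ i ∈ insert p (insert q R), ξ i = n)
    (hmax : ∀ i ∈ insert p (insert q R), ξ i ≤ 1 + 2 / n) (hp0 : 0 ≤ ξ p) (hpq' : ξ p ≤ ξ q)
    (hqmin : ∀ i ∈ R, ξ q ≤ ξ i) {E : Finset (Finset α)}
    (hE : E ⊆ (insert p (insert q R)).powersetCard 3) {s : ℝ} (hs : 200 * √n ≤ s)
    (hmiss : n - 1 + s ≤ (((insert p (insert q R)).powersetCard 3 \ E).card : ℝ)) :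
    ∑ e ∈ E, ∏ i ∈ e, ξ i ≤ n * (n - 1) * (n - 2) / 6 := by
  have hn0 : 0 < n := by linarith
  have hr0 : 0 ≤ √n := Real.sqrt_nonneg n
  have hrn : √n ^ 2 = n := Real.sq_sqrt hn0.le
  have hr1 : 160 ≤ √n := by
    rw [Real.le_sqrt (by norm_num) hn0.le]
    linarith
  have h2n : 2 / n ≤ 1 / 100 := by
    rw [div_le_div_iff₀ hn0 (by norm_num)]; linarith
  set z := ξ p with hz
  set a := ξ q with ha
  set V := insert p (insert q R) with hV
  set M := V.powersetCard 3 \ E with hM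
  set N := M.filter (fun A => ¬ (p ∈ A ∧ q ∈ A)) with hN
  set B := R.filter (fun i => {p, q, i} ∈ E) with hB
  set b : ℝ := (B.card : ℝ) with hb
  have hpV : p ∈ V := by simp [hV]
  have hqV : q ∈ V := by simp [hV]
  have hRV : ∀ i ∈ R, i ∈ V := fun i hi => by simp [hV, hi]
  have hb0 : 0 ≤ b := Nat.cast_nonneg _
  have hbn : b ≤ n - 1 := by
    rw [← hR]
    exact Nat.cast_le.2 (Finset.card_le_card (Finset.filter_subset _ R))
  have ha0 : 0 ≤ a := hp0.trans hpq'
  have ha1 : a ≤ 1 + 2 / n := hmax q hqV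
  have hz1 : z ≤ 1 + 2 / n := hmax p hpV
  have hzξ : ∀ i ∈ V, z ≤ ξ i := by
    intro i hi
    simp only [hV, Finset.mem_insert] at hi
    rcases hi with rfl | rfl | hi
    · exact le_rfl
    · exact hpq'
    · exact hpq'.trans (hqmin i hi)
  have hE_sum : ∑ e ∈ E, ∏ i ∈ e, ξ i
      = ∑ e ∈ V.powersetCard 3, ∏ i ∈ e, ξ i - ∑ e ∈ M, ∏ i ∈ e, ξ i := by
    rw [hM, ← Finset.sum_sdiff hE]
    ring
  have hM_sum : ∀ f : Finset α → ℝ, ∑ e ∈ M, f e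
      = ∑ i ∈ R.filter (fun i => {p, q, i} ∉ E), f {p, q, i} + ∑ e ∈ N, f e := by
    intro f
    rw [← sum_missing_pair hpq hpR hqR E f, hN]
    exact (Finset.sum_filter_add_sum_filter_not M _ f).symm
  have hR_sum : ∀ f : α → ℝ, ∑ i ∈ R.filter (fun i => {p, q, i} ∉ E), f i
      = ∑ i ∈ R, f i - ∑ i ∈ B, f i := by
    intro f
    rw [← Finset.sum_filter_add_sum_filter_not R (fun i => {p, q, i} ∈ E) f]
    ring
  have hNcard : b + s ≤ (N.card : ℝ) := by
    have h1 := hM_sum fun _ => 1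
    rw [hR_sum] at h1
    simp only [Finset.sum_const, nsmul_eq_mul, mul_one] at h1
    linarith
  have hM_weight : ∑ e ∈ M, ∏ i ∈ e, ξ i
      = z * a * ∑ i ∈ R, ξ i - z * a * ∑ i ∈ B, ξ i + ∑ e ∈ N, ∏ i ∈ e, ξ i := by
    rw [hM_sum, hR_sum, Finset.mul_sum, Finset.mul_sum]
    congr 2 <;>
    · refine Finset.sum_congr rfl fun i hi => ?_
      have hi' : i ∈ R := by first | exact hi | exact (Finset.mem_filter.1 hi).1
      have h1 : p ≠ i := by rintro rfl; exact hpR hi'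
      have h2 : q ≠ i := by rintro rfl; exact hqR hi'
      rw [Finset.prod_insert (by simp [hpq, h1]), Finset.prod_pair h2, mul_assoc]
  have hclique := sum_powersetCard_three_le hpq hpR hqR hR hsum
    (fun i hi => (hmax i (hRV i hi)).trans (by linarith)) (by linarith)
  have hBsum : ∑ i ∈ B, ξ i ≤ b * (1 + 2 / n) := by
    rw [← nsmul_eq_mul]
    exact Finset.sum_le_card_nsmul _ _ _ fun i hi => hmax i (hRV i (Finset.mem_filter.1 hi).1)
  have hb2 : b * (1 + 2 / n) ≤ b + 2 := by
    have : b * (2 / n) ≤ n * (2 / n) := mul_le_mul_of_nonneg_right (by linarith) (by positivity)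
    have : n * (2 / n) = 2 := by field_simp
    linarith
  have hza : z * a * ∑ i ∈ B, ξ i ≤ z * a * (b + 2) :=
    mul_le_mul_of_nonneg_left (hBsum.trans hb2) (mul_nonneg hp0 ha0)
  have hNsub : ∀ A ∈ N, A ⊆ V ∧ A.card = 3 ∧ ¬ (p ∈ A ∧ q ∈ A) := by
    intro A hA
    obtain ⟨h1, h2⟩ := Finset.mem_filter.1 hA
    obtain ⟨h3, h4⟩ := Finset.mem_powersetCard.1 (Finset.mem_sdiff.1 h1).1
    exact ⟨h3, h4, h2⟩
  have hξ0 : ∀ i ∈ V, 0 ≤ ξ i := fun i hi => hp0.trans (hzξ i hi)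
  rw [hE_sum, hM_weight]
  by_cases hv : 40 * √n ≤ (n - 4) * (1 - a)
  · -- the vertex `q` is light
    obtain ⟨N', hN', hN'card⟩ : ∃ N' ⊆ N, N'.card = B.card + 2 := by
      refine Finset.exists_subset_card_eq ?_
      have : (B.card : ℝ) + 2 ≤ N.card := by linarith
      exact_mod_cast this
    have hN'card' : (N'.card : ℝ) = b + 2 := by rw [hN'card]; push_cast; rfl
    have h1 := sum_prod_ge (D := fun i => max 0 (1 - ξ i)) (κ := n - 4) hpR hqR (by linarith) hp0
      hzξ (fun i _ => le_max_left _ _)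
      (fun i _ => by have := le_max_right 0 (1 - ξ i); linarith) (N := N')
      (fun A hA => (hNsub A (hN' hA)).2.1) (fun A hA => (hNsub A (hN' hA)).1)
      (fun A hA => (hNsub A (hN' hA)).2.2)
    rw [hN'card'] at h1
    have h2 : ∑ i ∈ R, max 0 (1 - ξ i) ^ 2 ≤ ∑ i ∈ R, (ξ i - 1) ^ 2 := by
      refine Finset.sum_le_sum fun i _ => ?_
      rcases max_cases 0 (1 - ξ i) with ⟨h, _⟩ | ⟨h, _⟩ <;> rw [h] <;> nlinarith
    have h3 : ∑ e ∈ N', ∏ i ∈ e, ξ i ≤ ∑ e ∈ N, ∏ i ∈ e, ξ i :=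
      Finset.sum_le_sum_of_subset_of_nonneg hN' fun A hA _ =>
        Finset.prod_nonneg fun i hi => hξ0 i ((hNsub A hA).1 hi)
    have h4 := light_numeric (N := n - 4) (e := b + 2) (a := a) (z := z) (r := √n) (by linarith)
      (by linarith) (by linarith) hp0 (by linarith) (by linarith) hr0 hv
    have h5 := mul_le_mul_of_nonneg_left h2 (show 0 ≤ (n - 4) / 2 by linarith)
    have h6 : (1 - a - z) ^ 2 = (z + a - 1) ^ 2 := by ring
    rw [h6] at h4
    simp only [mul_add] at hclique
    linarith
  · push Not at hv
    -- all weights outside `p` and `q` are close to the average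
    have hv0 : (1 - a) * n ≤ 41 * √n := by
      by_contra! h
      linarith
    set v := 41 / √n with hvdef
    have hrpos : 0 < √n := by linarith
    have hav : 1 - a ≤ v := by
      rw [hvdef, le_div_iff₀ hrpos]
      have : √n * ((1 - a) * √n) ≤ √n * 41 := by
        rw [show √n * ((1 - a) * √n) = (1 - a) * √n ^ 2 by ring, hrn]
        linarith
      exact le_of_mul_le_mul_left this hrpos
    have hv1 : v ≤ 41 / 160 := by
      rw [hvdef]
      exact div_le_div_of_nonneg_left (by norm_num) (by norm_num) hr1
    have hvpos : 0 ≤ v := by positivity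
    have hvn : v * n = 41 * √n := by
      rw [hvdef, div_mul_eq_mul_div, div_eq_iff hrpos.ne']
      linear_combination -41 * hrn
    have h1 : ∀ A ∈ N, z * (1 - 2 * v) ≤ ∏ i ∈ A, ξ i := by
      intro A hA
      obtain ⟨g1, g2, g3⟩ := hNsub A hA
      have hge : ∀ i ∈ R, 1 - v ≤ ξ i := fun i hi => by
        have := hqmin i hi
        linarith
      have hpair : ∀ w ∈ V, ∀ i ∈ R, ∀ j ∈ R, z * (1 - 2 * v) ≤ ξ w * (ξ i * ξ j) := by
        intro w hw i hi j hj
        refine mul_le_mul (hzξ w hw) ?_ (by linarith) (hξ0 w hw)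
        have := one_sub_sub_le_mul (hξ0 i (hRV i hi)) (hξ0 j (hRV j hj)) hvpos hvpos (hge i hi)
          (hge j hj)
        linarith
      rcases triple_cases g2 g1 g3 with h | ⟨w, i, j, hw, hi, hj, hij, hwi, hwj, rfl⟩
      · obtain ⟨x, y, t, hxy, hxt, hyt, rfl⟩ := Finset.card_eq_three.1 g2
        rw [Finset.prod_insert (by simp [hxy, hxt]), Finset.prod_pair hyt]
        exact hpair x (g1 (by simp)) y (h (by simp)) t (h (by simp))
      · rw [Finset.prod_insert (by simp [hwi, hwj]), Finset.prod_pair hij]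
        exact hpair w (g1 (by simp)) i hi j hj
    have h2 : (N.card : ℝ) * (z * (1 - 2 * v)) ≤ ∑ e ∈ N, ∏ i ∈ e, ξ i := by
      rw [← nsmul_eq_mul]
      exact Finset.card_nsmul_le_sum _ _ _ h1
    have h3 : (b + s) * (z * (1 - 2 * v)) ≤ (N.card : ℝ) * (z * (1 - 2 * v)) :=
      mul_le_mul_of_nonneg_right hNcard (mul_nonneg hp0 (by linarith))
    have h4 : a * (b + 2) ≤ b + 6 := by
      have : 2 / n * (b + 2) ≤ 2 / n * (n + n) :=
        mul_le_mul_of_nonneg_left (by linarith) (by positivity)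
      have : 2 / n * (n + n) = 4 := by field_simp; norm_num
      have : a * (b + 2) ≤ (1 + 2 / n) * (b + 2) :=
        mul_le_mul_of_nonneg_right ha1 (by linarith)
      linarith
    have h5 : b + 6 ≤ (b + s) * (1 - 2 * v) := by
      have : b * v ≤ 41 * √n := by
        rw [← hvn, mul_comm b]
        exact mul_le_mul_of_nonneg_left (by linarith) hvpos
      have : s * v ≤ s * (41 / 160) := mul_le_mul_of_nonneg_left hv1 (by linarith)
      linarith
    have h6 := mul_le_mul_of_nonneg_left (h4.trans h5) hp0
    have h7 : 0 ≤ (n - 4) / 2 * (∑ i ∈ R, (ξ i - 1) ^ 2 + (z + a - 1) ^ 2) :=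
      mul_nonneg (by linarith) (add_nonneg (Finset.sum_nonneg fun i _ => sq_nonneg _) (sq_nonneg _))
    linarith

end

theorem cast_choose_three (n : ℕ) : (n.choose 3 : ℝ) = n * (n - 1) * (n - 2) / 6 := by
  induction n with
  | zero => simp
  | succ n ih =>
    rw [Nat.choose_succ_succ' n 2, Nat.cast_add, ih, Nat.cast_choose_two]
    push_cast
    ring

theorem sum_powersetCard_three_le_of_card_le {α : Type*} {V : Finset α} {x : α → ℝ} (hx : ∀ i ∈ V, 0 ≤ x i)
    (hsum : ∑ i ∈ V, x i = 1) {n : ℝ} (hn : 4 ≤ n) (hV : (V.card : ℝ) ≤ n) :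
    ∑ e ∈ V.powersetCard 3, ∏ i ∈ e, x i ≤ (n - 1) * (n - 2) / (6 * n ^ 2) := by
  have hn0 : 0 < n := by linarith
  have h6 := six_mul_sum_powersetCard_three V x
  rw [hsum] at h6
  obtain ⟨c, hc⟩ : ∃ c, c = 1 / n := ⟨_, rfl⟩
  have hc0 : 0 < c := by rw [hc]; positivity
  have hcn : c * n = 1 := by rw [hc]; field_simp
  have hc1 : c ≤ 1 / 4 := by
    rw [hc]
    exact div_le_div_of_nonneg_left (by norm_num) (by norm_num) hn
  have h1 : ∀ i ∈ V, (3 * c ^ 2 - 2 * c ^ 3) + (6 * c - 6 * c ^ 2) * (x i - c)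
      ≤ 3 * x i ^ 2 - 2 * x i ^ 3 := by
    intro i hi
    have hxi : x i ≤ 1 := hsum ▸ Finset.single_le_sum hx hi
    have := mul_nonneg (sq_nonneg (x i - c)) (show 0 ≤ 3 - 2 * x i - 4 * c by linarith)
    linarith
  have h2 := Finset.sum_le_sum h1
  simp only [Finset.sum_add_distrib, Finset.sum_sub_distrib, ← Finset.mul_sum, hsum,
    Finset.sum_const, nsmul_eq_mul] at h2
  have h3 : (V.card : ℝ) * (3 * c ^ 2 - 4 * c ^ 3) ≤ n * (3 * c ^ 2 - 4 * c ^ 3) :=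
    mul_le_mul_of_nonneg_right hV (by nlinarith [pow_pos hc0 2])
  have h4 : n * (3 * c ^ 2 - 4 * c ^ 3) = 3 * c - 4 * c ^ 2 := by
    linear_combination (3 * c - 4 * c ^ 2) * hcn
  have h5 : (n - 1) * (n - 2) / (6 * n ^ 2) = (1 - 3 * c + 2 * c ^ 2) / 6 := by
    rw [hc]; field_simp; ring
  rw [h5]
  linarith

section

variable {α : Type*} [DecidableEq α]

/-- The weight of a `3`-graph with at most `(n + 1).choose 3 - (n - 1) - s` edges at an optimal
positive weighting is at most the Lagrangian of the complete `3`-graph on `n` vertices. -/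
theorem sum_prod_le_of_isMax {V : Finset α} {E : Finset (Finset α)} (hE : E ⊆ V.powersetCard 3)
    {x : α → ℝ} (hx : ∀ i ∈ V, 0 < x i) (hsum : ∑ i ∈ V, x i = 1)
    (hmax : ∀ y : α → ℝ, (∀ i ∈ V, 0 ≤ y i) → ∑ i ∈ V, y i = 1 →
      ∑ e ∈ E, ∏ i ∈ e, y i ≤ ∑ e ∈ E, ∏ i ∈ e, x i)
    {n : ℕ} (hn : (30000 : ℝ) ≤ n) {s : ℝ} (hs : 200 * √n ≤ s)
    (hcard : (E.card : ℝ) ≤ ((n + 1).choose 3 : ℝ) - (n - 1) - s) :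
    ∑ e ∈ E, ∏ i ∈ e, x i ≤ ((n : ℝ) - 1) * (n - 2) / (6 * n ^ 2) := by
  have hn0 : (0 : ℝ) < n := by linarith
  have hx0 : ∀ i ∈ V, 0 ≤ x i := fun i hi => (hx i hi).le
  have hs0 : 0 ≤ s := le_trans (by positivity) hs
  have hEc : ∀ e ∈ E, e.card = 3 := fun e he => (Finset.mem_powersetCard.1 (hE he)).2
  have hEV : ∀ e ∈ E, e ⊆ V := fun e he => (Finset.mem_powersetCard.1 (hE he)).1
  by_contra! hw
  have hVn : n < V.card := by
    by_contra! h
    refine absurd hw (not_lt.2 (le_trans ?_ (sum_powersetCard_three_le_of_card_le hx0 hsum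
      (n := n) (by linarith) (by exact_mod_cast h))))
    exact Finset.sum_le_sum_of_subset_of_nonneg hE fun e he _ =>
      Finset.prod_nonneg fun i hi => hx0 i ((Finset.mem_powersetCard.1 he).1 hi)
  have hVne : V.Nonempty := Finset.card_pos.1 (by omega)
  have hk0 : (0 : ℝ) < V.card := by exact_mod_cast Finset.card_pos.2 hVne
  have hlink : ∀ v ∈ V, 3 * ∑ e ∈ E, ∏ i ∈ e, x i ≤ linkWeight E x v := fun v hv =>
    three_mul_le_linkWeight hEc hx0 hsum hmax hv (hx v hv)
  obtain ⟨u, hu, humax⟩ := Finset.exists_max_image V x hVne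
  have hux := hx u hu
  set w := ∑ e ∈ E, ∏ i ∈ e, x i with hwdef
  have hw6 : 1 - 3 / (n : ℝ) + 2 / n ^ 2 < 6 * w := by
    have : 1 - 3 / (n : ℝ) + 2 / n ^ 2 = 6 * (((n : ℝ) - 1) * (n - 2) / (6 * n ^ 2)) := by
      field_simp; ring
    linarith
  have h1 := two_mul_linkWeight_le hE hx0 hsum hu
  have hp2 : 1 / (V.card : ℝ) ≤ ∑ i ∈ V, x i ^ 2 := by
    rw [div_le_iff₀ hk0]
    have := sq_sum_le_card_mul_sum_sq (s := V) (f := x)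
    rw [hsum] at this
    linarith
  have hI : 2 * x u - 2 * x u ^ 2 + 1 / (V.card : ℝ) ≤ 3 / (n : ℝ) - 2 / n ^ 2 := by
    have := hlink u hu
    linarith
  have hu2 : x u ≤ 1 / 2 := by
    by_contra! h
    have h2 : x u ^ 2 ≤ ∑ i ∈ V, x i ^ 2 :=
      Finset.single_le_sum (f := fun i => x i ^ 2) (fun i _ => sq_nonneg (x i)) hu
    have h3 := hlink u hu
    have h4 : x u ≤ 1 := hsum ▸ Finset.single_le_sum hx0 hu
    have h5 : 3 / (n : ℝ) ≤ 1 / 100 := by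
      rw [div_le_div_iff₀ hn0 (by norm_num)]; linarith
    have h6 : (0 : ℝ) ≤ 2 / n ^ 2 := by positivity
    nlinarith
  have hVn' : V.card = n + 1 := by
    by_contra hne
    have hk : (n : ℝ) + 2 ≤ V.card := by
      have : n + 2 ≤ V.card := by omega
      exact_mod_cast this
    have hX : (2 : ℝ) ≤ 1 / x u := by
      rw [le_div_iff₀ hux]; linarith
    have hXk : 1 / x u ≤ V.card := by
      rw [div_le_iff₀ hux, ← hsum, ← nsmul_eq_mul]
      exact Finset.sum_le_card_nsmul V x _ humax
    have hII := weight_mul_le_card hE hx0 (X := 1 / x u) (by positivity)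
      (fun i hi => by rw [div_mul_eq_mul_div, one_mul]; exact div_le_one_of_le₀ (humax i hi) hux.le)
      hlink
    refine support_bound_numeric (n := n) (k := V.card) (X := 1 / x u) (by linarith) hk hX hXk
      ?_ ?_
    · have : 2 / (1 / x u) - 2 / (1 / x u) ^ 2 = 2 * x u - 2 * x u ^ 2 := by field_simp
      rw [this]
      exact hI
    · set F := (1 / x u) ^ 2 * (3 * (V.card : ℝ) - 2 * (1 / x u)) with hF
      have hF0 : 0 ≤ F := mul_nonneg (sq_nonneg _) (by linarith)
      rw [← hwdef] at hII
      have h2 := mul_le_mul_of_nonneg_right hw.le hF0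
      have h3 : ((n : ℝ) - 1) * (n - 2) / (6 * n ^ 2) * F
          ≤ ((n : ℝ) - 1) * (n - 2) / (6 * n ^ 2) * (n ^ 2 * (n + 3)) := by
        refine (h2.trans hII).trans (hcard.trans ?_)
        rw [cast_choose_three]
        have : ((n : ℝ) - 1) * (n - 2) / (6 * n ^ 2) * (n ^ 2 * (n + 3))
            = (n - 1) * (n - 2) * (n + 3) / 6 := by field_simp
        rw [this]
        push_cast
        linarith
      refine le_of_mul_le_mul_left h3 (div_pos (mul_pos ?_ ?_) (by positivity)) <;> linarith
  have hnx : (n : ℝ) * x u ≤ 1 + 2 / n := by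
    refine max_weight_numeric (by linarith) hu2 ?_
    rw [hVn'] at hI
    push_cast at hI
    exact hI
  obtain ⟨p, hp, hpmin⟩ := Finset.exists_min_image V x hVne
  have hne : (V.erase p).Nonempty := by
    rw [← Finset.card_pos, Finset.card_erase_of_mem hp]
    have : 0 < n := by exact_mod_cast hn0
    omega
  obtain ⟨q, hq, hqmin⟩ := Finset.exists_min_image (V.erase p) x hne
  have hVeq : insert p (insert q ((V.erase p).erase q)) = V := by
    rw [Finset.insert_erase hq, Finset.insert_erase hp]
  have hR : (((V.erase p).erase q).card : ℝ) = n - 1 := by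
    have : ((V.erase p).erase q).card + 1 = n := by
      rw [Finset.card_erase_add_one hq, Finset.card_erase_of_mem hp]
      omega
    rw [← this]
    push_cast
    ring
  have hfin := sum_prod_le_of_card_eq_insert (p := p) (q := q) (R := (V.erase p).erase q)
    (n := n) (ξ := fun i => n * x i) (E := E) (s := s)
    (Finset.ne_of_mem_erase hq).symm (by simp) (by simp) hn hR
    (by rw [hVeq, ← Finset.mul_sum, hsum, mul_one])
    (fun i hi => (mul_le_mul_of_nonneg_left (humax i (hVeq ▸ hi)) hn0.le).trans hnx)
    (mul_nonneg hn0.le (hx0 p hp))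
    (mul_le_mul_of_nonneg_left (hpmin q (Finset.mem_of_mem_erase hq)) hn0.le)
    (fun i hi => mul_le_mul_of_nonneg_left (hqmin i (Finset.mem_of_mem_erase hi)) hn0.le)
    (by rw [hVeq]; exact hE) hs (by
      rw [hVeq, Finset.card_sdiff_of_subset hE, Nat.cast_sub (Finset.card_le_card hE),
        Finset.card_powersetCard, hVn']
      linarith)
  have hscale : ∑ e ∈ E, ∏ i ∈ e, (n : ℝ) * x i = n ^ 3 * w := by
    rw [hwdef, Finset.mul_sum]
    refine Finset.sum_congr rfl fun e he => ?_
    rw [Finset.prod_mul_distrib, Finset.prod_const, hEc e he]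
  rw [hscale] at hfin
  have h2 : (n : ℝ) ^ 3 * (((n : ℝ) - 1) * (n - 2) / (6 * n ^ 2)) < n ^ 3 * w :=
    mul_lt_mul_of_pos_left hw (by positivity)
  have h3 : (n : ℝ) ^ 3 * (((n : ℝ) - 1) * (n - 2) / (6 * n ^ 2)) = n * (n - 1) * (n - 2) / 6 := by
    field_simp
  linarith

end

/-- The Lagrangian of a `3`-graph with at most `(n + 1).choose 3 - (n - 1) - s` edges is at most
that of the complete `3`-graph on `n` vertices. -/
theorem RGraph.lagrangian_le {α : Type*} (H : RGraph α 3) {n : ℕ} (hn : (30000 : ℝ) ≤ n) {s : ℝ}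
    (hs : 200 * √n ≤ s) (hcard : (H.edges.card : ℝ) ≤ ((n + 1).choose 3 : ℝ) - (n - 1) - s) :
    H.lagrangian ≤ ((n : ℝ) - 1) * (n - 2) / (6 * n ^ 2) := by
  classical
  have hn0 : (0 : ℝ) < n := by linarith
  rcases H.verts.eq_empty_or_nonempty with hV | hV
  · have : {w : ℝ | ∃ x : α → ℝ, H.IsLegal x ∧ w = H.weight x} = ∅ := by
      refine Set.eq_empty_of_forall_notMem ?_
      rintro w ⟨x, ⟨-, h⟩, -⟩
      rw [hV, Finset.sum_empty] at h
      exact zero_ne_one h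
    rw [RGraph.lagrangian, this, Real.sSup_empty]
    exact div_nonneg (mul_nonneg (by linarith) (by linarith)) (by positivity)
  obtain ⟨⟨x, ⟨hx0, hx1⟩, hxw⟩, hub⟩ := H.isGreatest_lagrangian hV
  rw [hxw]
  set V := H.verts.filter (fun i => 0 < x i) with hVdef
  set E := H.edges.filter (fun e => e ⊆ V) with hEdef
  have hzero : ∀ i ∈ H.verts, i ∉ V → x i = 0 := fun i hi hiV =>
    le_antisymm (not_lt.1 fun h => hiV (Finset.mem_filter.2 ⟨hi, h⟩)) (hx0 i hi)
  have hweight : ∀ y : α → ℝ, (∀ i ∈ H.verts, i ∉ V → y i = 0) →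
      H.weight y = ∑ e ∈ E, ∏ i ∈ e, y i := by
    intro y hy
    rw [RGraph.weight, hEdef, Finset.sum_filter_of_ne]
    intro e he hne i hi
    by_contra hiV
    exact hne (Finset.prod_eq_zero hi (hy i (H.subset_verts e he hi) hiV))
  rw [hweight x hzero]
  refine sum_prod_le_of_isMax (V := V) (s := s) ?_ (fun i hi => (Finset.mem_filter.1 hi).2) ?_ ?_
    hn hs (le_trans (Nat.cast_le.2 (Finset.card_le_card (Finset.filter_subset _ _))) hcard)
  · intro e he
    obtain ⟨h1, h2⟩ := Finset.mem_filter.1 he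
    exact Finset.mem_powersetCard.2 ⟨h2, H.card_eq e h1⟩
  · rw [← hx1]
    exact Finset.sum_subset (Finset.filter_subset _ _) hzero
  · intro y hy0 hy1
    set y' : α → ℝ := fun i => if i ∈ V then y i else 0 with hy'
    have h1 : ∀ i ∈ H.verts, i ∉ V → y' i = 0 := fun i _ hiV => if_neg hiV
    have h2 : ∑ e ∈ E, ∏ i ∈ e, y i = ∑ e ∈ E, ∏ i ∈ e, y' i := by
      refine Finset.sum_congr rfl fun e he => Finset.prod_congr rfl fun i hi => ?_
      exact (if_pos ((Finset.mem_filter.1 he).2 hi)).symm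
    rw [h2, ← hweight y' h1, ← hweight x hzero, ← hxw]
    refine hub ⟨y', ⟨fun i _ => ?_, ?_⟩, rfl⟩
    · by_cases hi : i ∈ V
      · rw [hy']; simpa [hi] using hy0 i hi
      · rw [hy']; simp [hi]
    · rw [← hy1, ← Finset.sum_subset (Finset.filter_subset _ _) h1]
      exact Finset.sum_congr rfl fun i hi => if_pos hi

theorem powersetCard_range_subset_colexEdges {n m : ℕ} (hn : 3 ≤ n) (hm : n.choose 3 ≤ m) :
    (Finset.range n).powersetCard 3 ⊆ colexEdges 3 m := by
  have hnm : n ≤ m + 3 := by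
    obtain ⟨k, rfl⟩ := Nat.exists_eq_add_of_le hn
    have h1 : k + 1 ≤ (k + 3).choose 3 := by
      rw [show k + 3 = (k + 2) + 1 by ring, Nat.choose_succ_succ' (k + 2) 2,
        Nat.choose_succ_succ' (k + 1) 1, Nat.choose_one_right]
      omega
    rw [Nat.add_comm 3 k] at hm
    omega
  intro A hA
  obtain ⟨hAr, hAc⟩ := Finset.mem_powersetCard.1 hA
  refine Finset.mem_filter.2 ⟨Finset.mem_powersetCard.2
    ⟨hAr.trans (Finset.range_subset_range.2 hnm), hAc⟩, ?_⟩
  have hss : (((Finset.range (m + 3)).powersetCard 3).filter fun B => toColex B < toColex A)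
      ⊂ (Finset.range n).powersetCard 3 := by
    refine Finset.ssubset_iff_subset_ne.2 ⟨?_, ?_⟩
    · intro B hB
      obtain ⟨h1, h2⟩ := Finset.mem_filter.1 hB
      refine Finset.mem_powersetCard.2 ⟨fun b hb => ?_, (Finset.mem_powersetCard.1 h1).2⟩
      exact Finset.mem_range.2 (Finset.Colex.forall_lt_mono h2.le
        (fun c hc => Finset.mem_range.1 (hAr hc)) b hb)
    · intro h
      rw [← h] at hA
      exact lt_irrefl _ (Finset.mem_filter.1 hA).2
  have := Finset.card_lt_card hss
  rw [Finset.card_powersetCard, Finset.card_range] at this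
  omega

theorem le_lagrangian_colexGraph {n m : ℕ} (hn : 3 ≤ n) (hm : n.choose 3 ≤ m) :
    (n.choose 3 : ℝ) / n ^ 3 ≤ (colexGraph 3 m).lagrangian := by
  have hsub := powersetCard_range_subset_colexEdges hn hm
  have hrange : Finset.range n ⊆ (colexGraph 3 m).verts := by
    intro i hi
    obtain ⟨A, hiA, hA, hAc⟩ := Finset.exists_subsuperset_card_eq
      (Finset.singleton_subset_iff.2 hi) (n := 3) (by simp) (by simpa using hn)
    exact Finset.mem_biUnion.2 ⟨A, hsub (Finset.mem_powersetCard.2 ⟨hA, hAc⟩),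
      Finset.singleton_subset_iff.1 hiA⟩
  have hne : (colexGraph 3 m).verts.Nonempty := ⟨0, hrange (Finset.mem_range.2 (by omega))⟩
  have hn0 : (n : ℝ) ≠ 0 := by
    have : n ≠ 0 := by omega
    exact_mod_cast this
  set x : ℕ → ℝ := fun i => if i ∈ Finset.range n then 1 / (n : ℝ) else 0 with hx
  have hx0 : ∀ i, 0 ≤ x i := fun i => by rw [hx]; dsimp only; split_ifs <;> positivity
  have hlegal : (colexGraph 3 m).IsLegal x := by
    refine ⟨fun i _ => hx0 i, ?_⟩
    rw [← Finset.sum_subset hrange fun i _ hi => if_neg hi,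
      Finset.sum_congr rfl fun i hi => if_pos hi]
    rw [Finset.sum_const, Finset.card_range, nsmul_eq_mul]
    field_simp
  refine le_trans ?_ (((colexGraph 3 m).isGreatest_lagrangian hne).2 ⟨x, hlegal, rfl⟩)
  refine le_trans (le_of_eq ?_) (Finset.sum_le_sum_of_subset_of_nonneg hsub fun e _ _ =>
    Finset.prod_nonneg fun i _ => hx0 i)
  rw [Finset.sum_congr rfl (g := fun _ => (1 / (n : ℝ)) ^ 3), Finset.sum_const,
    Finset.card_powersetCard, Finset.card_range, nsmul_eq_mul]
  · rw [one_div_pow, mul_one_div]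
  · intro e he
    obtain ⟨h1, h2⟩ := Finset.mem_powersetCard.1 he
    rw [← h2, ← Finset.prod_const]
    exact Finset.prod_congr rfl fun i hi => if_pos (h1 hi)

theorem corollary4 :
    ∃ c : ℝ, 0 < c ∧ ∀ t m : ℕ, 2 ≤ t →
      (t - 1).choose 3 ≤ m →
      (m : ℝ) ≤ (t.choose 3 : ℝ) - ((t : ℝ) - 2) - c * (t : ℝ) ^ ((2 : ℝ) / 3) →
        IsGreatest (lagrangianValues 3 m) (maxLagrangian 3 m) ∧
        maxLagrangian 3 m = ((t - 1).choose 3 : ℝ) / ((t : ℝ) - 1) ^ 3 ∧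
        maxLagrangian 3 m = (colexGraph 3 m).lagrangian := by
  refine ⟨10 ^ 10, by norm_num, ?_⟩
  intro t m ht hm hmt
  obtain ⟨n, rfl⟩ : ∃ n, t = n + 1 := ⟨t - 1, by omega⟩
  rw [Nat.add_sub_cancel] at hm ⊢
  set s : ℝ := 10 ^ 10 * ((n + 1 : ℕ) : ℝ) ^ ((2 : ℝ) / 3) with hs
  have ht1 : (1 : ℝ) ≤ ((n + 1 : ℕ) : ℝ) := by push_cast; linarith [Nat.cast_nonneg (α := ℝ) n]
  have hpow : √n ≤ ((n + 1 : ℕ) : ℝ) ^ ((2 : ℝ) / 3) := by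
    calc √(n : ℝ) ≤ √((n + 1 : ℕ) : ℝ) := Real.sqrt_le_sqrt (by push_cast; linarith)
      _ = ((n + 1 : ℕ) : ℝ) ^ ((1 : ℝ) / 2) := Real.sqrt_eq_rpow _
      _ ≤ _ := Real.rpow_le_rpow_of_exponent_le ht1 (by norm_num)
  have hpow1 : (1 : ℝ) ≤ ((n + 1 : ℕ) : ℝ) ^ ((2 : ℝ) / 3) :=
    Real.one_le_rpow ht1 (by norm_num)
  have hm' : (n.choose 3 : ℝ) ≤ m := by exact_mod_cast hm
  have hn : (30000 : ℝ) ≤ n := by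
    have h1 := hm'.trans hmt
    rw [cast_choose_three, cast_choose_three] at h1
    have h2 : (10 : ℝ) ^ 10 ≤ s := by linarith
    push_cast at h1
    by_contra! h
    nlinarith [Nat.cast_nonneg (α := ℝ) n]
  have hn0 : (0 : ℝ) < n := by linarith
  have hs200 : 200 * √n ≤ s := by linarith [Real.sqrt_nonneg (n : ℝ)]
  have hvalue : ((n : ℝ) - 1) * (n - 2) / (6 * n ^ 2)
      = (n.choose 3 : ℝ) / (((n + 1 : ℕ) : ℝ) - 1) ^ 3 := by
    rw [cast_choose_three]
    push_cast
    rw [add_sub_cancel_right]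
    field_simp
  have hupper : ∀ (α : Type) (H : RGraph α 3), H.edges.card = m →
      H.lagrangian ≤ (n.choose 3 : ℝ) / (((n + 1 : ℕ) : ℝ) - 1) ^ 3 := by
    intro α H hH
    rw [← hvalue]
    refine H.lagrangian_le hn hs200 ?_
    rw [hH]
    refine hmt.trans (le_of_eq ?_)
    push_cast
    ring
  have hcolex_card : (colexGraph 3 m).edges.card = m := card_colexEdges (by norm_num) m
  have hcolex : (colexGraph 3 m).lagrangian
      = (n.choose 3 : ℝ) / (((n + 1 : ℕ) : ℝ) - 1) ^ 3 := by
    refine le_antisymm (hupper ℕ _ hcolex_card) ?_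
    have hn3 : 3 ≤ n := by
      have : (3 : ℝ) ≤ n := by linarith
      exact_mod_cast this
    have := le_lagrangian_colexGraph hn3 hm
    push_cast
    rwa [add_sub_cancel_right]
  have hgreat : IsGreatest (lagrangianValues 3 m)
      ((n.choose 3 : ℝ) / (((n + 1 : ℕ) : ℝ) - 1) ^ 3) := by
    refine ⟨⟨ℕ, colexGraph 3 m, hcolex_card, hcolex.symm⟩, ?_⟩
    rintro v ⟨α, H, hH, rfl⟩
    exact hupper α H hH
  have hmaxL : maxLagrangian 3 m = (n.choose 3 : ℝ) / (((n + 1 : ℕ) : ℝ) - 1) ^ 3 :=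
    hgreat.csSup_eq
  exact ⟨hmaxL ▸ hgreat, hmaxL, hmaxL.trans hcolex.symm⟩
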